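/- Let $I\subset\mathbb R$ be a bounded interval with more than one point (open, closed or half-open), and let $n\ge 1$ be an integer. For a real function $f$ on an interval $J$ and a Hermitian matrix $A$ with spectrum in $J$, let $f(A)$ be given by the functional calculus, and let $\le$ between Hermitian matrices be the Loewner order. The function $f$ is called $n$-convex in $J$ if $f(\lambda A+(1-\lambda)B)\le\lambda f(A)+(1-\lambda)f(B)$ for all $\lambda\in[0,1]$ and all complex Hermitian $n\times n$ matrices $A,B$ with spectra in $J$. It is called $n$-monotone increasing (respectively $n$-monotone decreasing) in $J$ if $A\le B$ implies $f(A)\le f(B)$ (respectively $f(B)\le f(A)$) for all such $A,B$. Then there is a function $f\colon I\to\mathbb R$ which is $n$-convex in $I$ but whose restriction to $J$ is not $(n+1)$-convex for any interval $J\subseteq I$ with more than one point. If $n\ge 2$, such a function can be chosen as a polynomial of degree $2n$ that is $n$-monotone increasing in $I$, and it can also be chosen as a polynomial of degree $2n$ that is $n$-monotone decreasing in $I$. -/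

import Mathlib

open scoped MatrixOrder

/-- `f` is `n`-convex on the interval `I`:
`f (c A + (1 - c) B) ≤ c f(A) + (1 - c) f(B)` in the Loewner order, for all complex Hermitian
`n × n` matrices `A`, `B` with spectra in `I` and all `c ∈ [0, 1]`. Here `f(A) = cfc f A` is the
spectral functional calculus; no continuity of `f` is needed, since spectra are finite, and only
the values of `f` on `I` matter. -/
def NConvexOn (n : ℕ) (I : Set ℝ) (f : ℝ → ℝ) : Prop :=
  ∀ A B : Matrix (Fin n) (Fin n) ℂ, A.IsHermitian → B.IsHermitian →
    spectrum ℝ A ⊆ I → spectrum ℝ B ⊆ I →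
    ∀ c : ℝ, 0 ≤ c → c ≤ 1 →
      cfc f (c • A + (1 - c) • B) ≤ c • cfc f A + (1 - c) • cfc f B

/-- `f` is `n`-monotone (increasing) on the interval `I`: `A ≤ B` implies `f(A) ≤ f(B)` for all
complex Hermitian `n × n` matrices `A`, `B` with spectra in `I`. -/
def NMonotoneOn (n : ℕ) (I : Set ℝ) (f : ℝ → ℝ) : Prop :=
  ∀ A B : Matrix (Fin n) (Fin n) ℂ, A.IsHermitian → B.IsHermitian →
    spectrum ℝ A ⊆ I → spectrum ℝ B ⊆ I → A ≤ B → cfc f A ≤ cfc f B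

/-- `f` is `n`-monotone decreasing on the interval `I`: `A ≤ B` implies `f(B) ≤ f(A)` for all
complex Hermitian `n × n` matrices `A`, `B` with spectra in `I`. -/
def NAntitoneOn (n : ℕ) (I : Set ℝ) (f : ℝ → ℝ) : Prop :=
  ∀ A B : Matrix (Fin n) (Fin n) ℂ, A.IsHermitian → B.IsHermitian →
    spectrum ℝ A ⊆ I → spectrum ℝ B ⊆ I → A ≤ B → cfc f B ≤ cfc f A

/-- `f` is `n`-convex on `I`, but not `(n + 1)`-convex on any subinterval of `I` (intervals are
order-connected subsets of the real line with at least two points). -/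
def InConvexityGap (n : ℕ) (I : Set ℝ) (f : ℝ → ℝ) : Prop :=
  NConvexOn n I f ∧
    ∀ J : Set ℝ, J ⊆ I → J.OrdConnected → J.Nontrivial → ¬ NConvexOn (n + 1) J f

/-!
Write a polynomial as `p = ∑ k, b k * t ^ k`. Along a line of Hermitian matrices with direction `H`,
half the second derivative of `⟪v, p(X) v⟫` is
`∑ i j l, b (i + j + l + 2) * ⟪H X ^ i v, X ^ j (H X ^ l v)⟫` (`hasDerivAt_polyDeriv_line`).

*Convexity.* Put `w i = H X ^ i v`. For `n × n` matrices `X` of small norm, the Cayley–Hamilton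
relation expresses `w i` with `i ≥ n` by `w 0, …, w (n - 1)` with small coefficients
(`exists_pow_eq_sum_of_norm_le`). So all terms with `j ≥ 1`, `i ≥ n` or `l ≥ n` are small compared
with `∑ i < n, ‖w i‖ ^ 2`, while the remaining ones form the Hankel form
`∑ i l < n, b (i + l + 2) * ⟪w i, w l⟫`. If the `b k` are moments of a positive measure with `n`
atoms, this form is coercive by invertibility of the Vandermonde matrix, and it dominates
(`sum_hankel_inner_nonneg`, `exists_nConvexOn_Icc`). The first derivative in a direction `Kᴴ * K` is
`∑ i j, b (i + j + 1) * ⟪K X ^ i v, K X ^ j v⟫`, to which the same estimate applies, and yields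
`n`-monotonicity near `0` (`exists_nMonotoneOn_Icc`). The moments `b k = ∑ s, (s + 1) ^ k`, up to any
degree `D ≥ 2 * n`, serve both purposes. Rescaling the variable replaces the neighbourhood of `0` by
a given bounded interval, and a negative scaling factor turns increasing into decreasing.

*Failure of convexity.* Let `p` have degree `a + b + 2` with `a < b`. For a diagonal matrix `X` with
`b + 1` distinct entries `x s`, `H = h hᵀ` and `v = (1, …, 1)`, the second derivative only involves
the moments `∑ s, h s * x s ^ i` and `∑ s, h s ^ 2 * x s ^ j`. The former may be prescribed for
`i ≤ b`; with `1` at `b`, `-δ` at `a` and `0` elsewhere, the second derivative is negative for small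
`δ` (`not_nConvexOn_of_natDegree_eq`). For `n ≥ 2` this applies to degree `2 * n` with
`(a, b) = (n - 2, n)`, and for `n = 1` to degree `3` with `(a, b) = (0, 1)`.
-/

/-! ### Derivatives of polynomials along lines in a noncommutative algebra -/

/-- Reindexing of the terms `X ^ i * H * X ^ j`, `i + j = k - 1`, in the derivative of a power
`X ^ k`, by the pair `(i, j)`; pairs with `i + j + 1 ≥ d` have coefficient `0`. -/
theorem sum_range_smul_sum_range {V : Type*} [AddCommGroup V] [Module ℝ V] (d : ℕ) (b : ℕ → ℝ)
    (hb : ∀ k, d ≤ k → b k = 0) (F : ℕ → ℕ → V) :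
    ∑ k ∈ Finset.range d, b k • ∑ i ∈ Finset.range k, F i (k - 1 - i) =
      ∑ i ∈ Finset.range d, ∑ j ∈ Finset.range d, b (i + j + 1) • F i j := by
  simp_rw [Finset.smul_sum]
  rw [Finset.sum_sigma', ← Finset.sum_product']
  refine Finset.sum_bij_ne_zero (fun x _ _ => (x.2, x.1 - 1 - x.2)) ?_ ?_ ?_ ?_
  · rintro ⟨k, i⟩ h -
    simp only [Finset.mem_sigma, Finset.mem_range, Finset.mem_product] at h ⊢
    omega
  · rintro ⟨k, i⟩ h - ⟨k', i'⟩ h' - he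
    simp only [Finset.mem_sigma, Finset.mem_range, Prod.mk.injEq] at h h' he
    obtain ⟨rfl, he⟩ := he
    obtain rfl : k = k' := by omega
    rfl
  · rintro ⟨i, j⟩ h h0
    have hlt : i + j + 1 < d := by
      by_contra hge
      exact h0 (by simp [hb _ (not_lt.mp hge)])
    refine ⟨⟨i + j + 1, i⟩, by simp; omega, ?_, ?_⟩
    · simpa [show i + j + 1 - 1 - i = j by omega] using h0
    · simp
  · rintro ⟨k, i⟩ h -
    simp only [Finset.mem_sigma, Finset.mem_range] at h
    simp only
    congr 2
    omega

section LineDeriv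

variable {𝔸 : Type*} [NormedRing 𝔸] [NormedAlgebra ℝ 𝔸]

/-- The first derivative of `p` at `X` in the direction `H`, provided `p.natDegree < d`. -/
noncomputable def polyDeriv (p : Polynomial ℝ) (d : ℕ) (X H : 𝔸) : 𝔸 :=
  ∑ i ∈ Finset.range d, ∑ j ∈ Finset.range d, p.coeff (i + j + 1) • (X ^ i * H * X ^ j)

/-- Half the second derivative of `p` at `X` in the direction `H`, provided `p.natDegree < d`. -/
noncomputable def polyHalfDeriv2 (p : Polynomial ℝ) (d : ℕ) (X H : 𝔸) : 𝔸 :=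
  ∑ i ∈ Finset.range d, ∑ j ∈ Finset.range d, ∑ l ∈ Finset.range d,
    p.coeff (i + j + l + 2) • (X ^ i * H * X ^ j * H * X ^ l)

theorem hasDerivAt_line (X H : 𝔸) (t : ℝ) : HasDerivAt (fun s : ℝ => X + s • H) H t := by
  simpa using ((hasDerivAt_id t).smul_const H).const_add X

theorem hasDerivAt_line_pow (X H : 𝔸) (t : ℝ) (k : ℕ) :
    HasDerivAt (fun s : ℝ => (X + s • H) ^ k)
      (∑ i ∈ Finset.range k, (X + t • H) ^ i * H * (X + t • H) ^ (k - 1 - i)) t := by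
  have h := (hasDerivAt_line X H t).fun_pow' k
  rw [← Finset.sum_range_reflect] at h
  convert h using 1
  refine Finset.sum_congr rfl fun i hi => ?_
  have := Finset.mem_range.mp hi
  rw [show k.pred - (k - 1 - i) = i by simp [Nat.pred_eq_sub_one]; omega]

theorem hasDerivAt_aeval_line (p : Polynomial ℝ) {d : ℕ} (hd : p.natDegree < d) (X H : 𝔸)
    (t : ℝ) :
    HasDerivAt (fun s : ℝ => Polynomial.aeval (X + s • H) p) (polyDeriv p d (X + t • H) H) t := by
  have h : HasDerivAt (fun s : ℝ => ∑ k ∈ Finset.range d, p.coeff k • (X + s • H) ^ k)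
      (∑ k ∈ Finset.range d, p.coeff k •
        ∑ i ∈ Finset.range k, (X + t • H) ^ i * H * (X + t • H) ^ (k - 1 - i)) t :=
    HasDerivAt.fun_sum fun k _ => (hasDerivAt_line_pow X H t k).const_smul (p.coeff k)
  rw [sum_range_smul_sum_range d p.coeff
    (fun k hk => p.coeff_eq_zero_of_natDegree_lt (by omega))
    (fun i j => (X + t • H) ^ i * H * (X + t • H) ^ j)] at h
  simpa only [Polynomial.aeval_eq_sum_range' hd, polyDeriv] using h

theorem hasDerivAt_polyDeriv_line (p : Polynomial ℝ) {d : ℕ} (hd : p.natDegree < d) (X H : 𝔸)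
    (t : ℝ) :
    HasDerivAt (fun s : ℝ => polyDeriv p d (X + s • H) H)
      ((2 : ℝ) • polyHalfDeriv2 p d (X + t • H) H) t := by
  have hc : ∀ k, d ≤ k → p.coeff k = 0 := fun k hk =>
    p.coeff_eq_zero_of_natDegree_lt (by omega)
  set Y := X + t • H with hY
  have h : HasDerivAt (fun s : ℝ => polyDeriv p d (X + s • H) H)
      (∑ i ∈ Finset.range d, ∑ j ∈ Finset.range d, p.coeff (i + j + 1) •
        ((∑ a ∈ Finset.range i, Y ^ a * H * Y ^ (i - 1 - a)) * H * Y ^ j +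
          Y ^ i * H * ∑ a ∈ Finset.range j, Y ^ a * H * Y ^ (j - 1 - a))) t := by
    refine HasDerivAt.fun_sum fun i _ => HasDerivAt.fun_sum fun j _ => ?_
    refine HasDerivAt.const_smul (p.coeff (i + j + 1)) ?_
    exact ((hasDerivAt_line_pow X H t i).mul_const H).mul (hasDerivAt_line_pow X H t j)
  convert h using 1
  simp_rw [smul_add, Finset.sum_add_distrib]
  rw [two_smul]
  congr 1
  · rw [Finset.sum_comm (s := Finset.range d) (t := Finset.range d)
      (f := fun i j => p.coeff (i + j + 1) •
        ((∑ a ∈ Finset.range i, Y ^ a * H * Y ^ (i - 1 - a)) * H * Y ^ j))]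
    have key : ∀ j ∈ Finset.range d, (∑ i ∈ Finset.range d, p.coeff (i + j + 1) •
        ((∑ a ∈ Finset.range i, Y ^ a * H * Y ^ (i - 1 - a)) * H * Y ^ j)) =
        ∑ a ∈ Finset.range d, ∑ e ∈ Finset.range d,
          p.coeff (a + e + 1 + j + 1) • (Y ^ a * H * Y ^ e * H * Y ^ j) := by
      intro j _
      simp_rw [Finset.sum_mul]
      exact sum_range_smul_sum_range d (fun k => p.coeff (k + j + 1))
        (fun k hk => hc _ (by omega)) (fun a e => Y ^ a * H * Y ^ e * H * Y ^ j)
    rw [Finset.sum_congr rfl key, Finset.sum_comm, polyHalfDeriv2]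
    refine Finset.sum_congr rfl fun a _ => ?_
    conv_rhs => rw [Finset.sum_comm]
    refine Finset.sum_congr rfl fun e _ => Finset.sum_congr rfl fun j _ => ?_
    rw [show a + e + 1 + j + 1 = a + e + j + 2 by omega]
  · rw [polyHalfDeriv2]
    refine Finset.sum_congr rfl fun i _ => ?_
    simp_rw [Finset.mul_sum]
    rw [sum_range_smul_sum_range d (fun k => p.coeff (i + k + 1))
        (fun k hk => hc _ (by omega)) (fun a e => Y ^ i * H * (Y ^ a * H * Y ^ e))]
    refine Finset.sum_congr rfl fun a _ => Finset.sum_congr rfl fun e _ => ?_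
    rw [show i + (a + e + 1) + 1 = i + a + e + 2 by omega]
    simp only [mul_assoc]

end LineDeriv

/-! ### Hankel forms and vectors satisfying a recursion -/

section Hankel

open Finset

variable {E : Type*} [NormedAddCommGroup E] [InnerProductSpace ℂ E]

/-- A Hankel form of discrete moments is coercive: with `n` distinct nodes, the Vandermonde matrix
can be inverted to recover the vectors `w i` from the combinations `∑ i, x s ^ i • w i`. -/
theorem exists_sum_norm_sq_le_sum_vandermonde (n : ℕ) (x : Fin n → ℝ)
    (hx : Function.Injective x) :
    ∃ C : ℝ, 0 < C ∧ ∀ w : ℕ → E, ∑ i ∈ range n, ‖w i‖ ^ 2 ≤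
      C * ∑ s : Fin n, ‖∑ i ∈ range n, x s ^ i • w i‖ ^ 2 := by
  have hdet : IsUnit (Matrix.vandermonde x).det :=
    isUnit_iff_ne_zero.mpr (Matrix.det_vandermonde_ne_zero_iff.mpr hx)
  set V := Matrix.vandermonde x with hV
  refine ⟨(∑ i, ∑ s, |V⁻¹ i s| ^ 2) + 1, by positivity, fun w => ?_⟩
  set z : Fin n → E := fun s => ∑ i ∈ range n, x s ^ i • w i with hz
  have hw : ∀ i : Fin n, w i = ∑ s, V⁻¹ i s • z s := by
    intro i
    have hz' : ∀ s, z s = ∑ j : Fin n, V s j • w j := fun s => by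
      simp only [hz, hV, Matrix.vandermonde_apply]
      rw [Finset.sum_range]
    simp_rw [hz', smul_sum, smul_smul]
    rw [sum_comm]
    simp_rw [← sum_smul, ← Matrix.mul_apply, Matrix.nonsing_inv_mul V hdet, Matrix.one_apply]
    simp
  rw [Finset.sum_range (fun i => ‖w i‖ ^ 2)]
  have hbound : ∀ i : Fin n, ‖w i‖ ^ 2 ≤ (∑ s, |V⁻¹ i s| ^ 2) * ∑ s, ‖z s‖ ^ 2 := by
    intro i
    calc ‖w i‖ ^ 2 ≤ (∑ s, |V⁻¹ i s| * ‖z s‖) ^ 2 := by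
          gcongr
          rw [hw i]
          refine (norm_sum_le _ _).trans (le_of_eq ?_)
          simp [norm_smul]
      _ ≤ _ := sum_mul_sq_le_sq_mul_sq _ _ _
  calc ∑ i : Fin n, ‖w i‖ ^ 2 ≤ ∑ i : Fin n, (∑ s, |V⁻¹ i s| ^ 2) * ∑ s, ‖z s‖ ^ 2 :=
        sum_le_sum fun i _ => hbound i
    _ = (∑ i, ∑ s, |V⁻¹ i s| ^ 2) * ∑ s, ‖z s‖ ^ 2 := by rw [sum_mul]
    _ ≤ _ := by gcongr; linarith

/-- The Hankel form of the moments of a measure with masses `y s` at the points `x s` is a sum of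
squares. -/
theorem sum_sum_moment_inner_eq (n : ℕ) (x y : Fin n → ℝ) (w : ℕ → E) :
    ∑ i ∈ range n, ∑ l ∈ range n,
        (∑ s, y s * x s ^ (i + l)) * (inner ℂ (w i) (w l)).re =
      ∑ s, y s * ‖∑ i ∈ range n, x s ^ i • w i‖ ^ 2 := by
  have hterm : ∀ (a b : ℝ) (u v : E),
      (inner ℂ (a • u) (b • v)).re = a * b * (inner ℂ u v).re := fun a b u v => by
    rw [inner_smul_left_eq_smul, inner_smul_right_eq_smul]
    simp [mul_assoc]
  have h : ∀ s, ‖∑ i ∈ range n, x s ^ i • w i‖ ^ 2 =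
      ∑ i ∈ range n, ∑ l ∈ range n, x s ^ (i + l) * (inner ℂ (w i) (w l)).re := by
    intro s
    rw [← inner_self_eq_norm_sq (𝕜 := ℂ), sum_inner]
    simp_rw [inner_sum, map_sum, pow_add]
    exact sum_congr rfl fun i _ => sum_congr rfl fun l _ => hterm _ _ _ _
  simp_rw [h, mul_sum, sum_mul]
  symm
  rw [sum_comm]
  refine sum_congr rfl fun i _ => ?_
  rw [sum_comm]
  simp_rw [mul_assoc]

/-- Let the vectors `w i` satisfy a linear recursion of order `n` with small coefficients, and let
`A` be small. Then in the sum below the terms with `j = 0` and `i, l < n` dominate all others, so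
that the sum inherits its sign from the Hankel form of `g`. -/
theorem sum_hankel_inner_nonneg {n d : ℕ} (hnd : n ≤ d) {g : ℕ → ℝ} {c M θ : ℝ} 
    (hpos : ∀ w : ℕ → E, c * ∑ i ∈ range n, ‖w i‖ ^ 2 ≤
      ∑ i ∈ range n, ∑ l ∈ range n, g (i + l) * (inner ℂ (w i) (w l)).re)
    (hg : ∀ k, |g k| ≤ M) (hθ : 0 ≤ θ) (hθ1 : θ ≤ 1) (hc : d ^ 3 * (M * θ) ≤ c)
    {A : E →L[ℂ] E} (hA : ‖A‖ ≤ θ) {a : ℕ → ℂ} (ha : ∑ l ∈ range n, ‖a l‖ ≤ θ)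
    {w : ℕ → E} (hw : ∀ i, w (i + n) = ∑ l ∈ range n, a l • w (i + l)) :
    0 ≤ ∑ i ∈ range d, ∑ j ∈ range d, ∑ l ∈ range d,
      g (i + j + l) * (inner ℂ (w i) ((A ^ j) (w l))).re := by
  have hM : 0 ≤ M := (abs_nonneg _).trans (hg 0)
  -- `T` bounds `w i` for `i < n`, hence for all `i`; from `n` on, the recursion gains a factor `θ`.
  set S := ∑ i ∈ range n, ‖w i‖ ^ 2 with hS
  have hS0 : 0 ≤ S := by positivity
  set T := √S with hT
  have hT0 : 0 ≤ T := Real.sqrt_nonneg _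
  have hTT : T * T = S := Real.mul_self_sqrt hS0
  have hlow : ∀ i < n, ‖w i‖ ≤ T := fun i hi => by
    rw [hT]
    refine Real.le_sqrt_of_sq_le ?_
    exact single_le_sum (f := fun i => ‖w i‖ ^ 2) (fun _ _ => by positivity) (mem_range.mpr hi)
  have hstep : ∀ i, (∀ l < n, ‖w (i + l)‖ ≤ T) → ‖w (i + n)‖ ≤ θ * T := fun i h => by
    rw [hw]
    calc ‖∑ l ∈ range n, a l • w (i + l)‖ ≤ ∑ l ∈ range n, ‖a l‖ * T := by
          refine norm_sum_le_of_le _ fun l hl => ?_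
          rw [norm_smul]
          gcongr
          exact h l (mem_range.mp hl)
      _ ≤ θ * T := by rw [← sum_mul]; gcongr
  have hall : ∀ i, ‖w i‖ ≤ T := by
    intro i
    induction i using Nat.strong_induction_on with
    | _ i ih =>
      rcases lt_or_ge i n with h | h
      · exact hlow i h
      · obtain ⟨k, rfl⟩ := Nat.exists_eq_add_of_le' h
        exact (hstep k fun l hl => ih _ (by omega)).trans (mul_le_of_le_one_left hT0 hθ1)
  have hhigh : ∀ i, n ≤ i → ‖w i‖ ≤ θ * T := fun i h => by
    obtain ⟨k, rfl⟩ := Nat.exists_eq_add_of_le' h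
    exact hstep k fun l _ => hall _
  have hAj : ∀ j v, ‖(A ^ j) v‖ ≤ θ ^ j * ‖v‖ := by
    intro j v
    induction j with
    | zero => simp
    | succ j ih =>
      rw [pow_succ', mul_apply_eq_comp, pow_succ', mul_assoc]
      exact (A.le_opNorm _).trans (mul_le_mul hA ih (norm_nonneg _) hθ)
  have hsmall : ∀ i j l, ¬ (j = 0 ∧ i < n ∧ l < n) →
      ‖inner ℂ (w i) ((A ^ j) (w l))‖ ≤ θ * S := by
    intro i j l h
    have hpow : θ ^ j ≤ 1 := pow_le_one₀ hθ hθ1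
    have h1 : ‖inner ℂ (w i) ((A ^ j) (w l))‖ ≤ ‖w i‖ * (θ ^ j * ‖w l‖) :=
      (norm_inner_le_norm _ _).trans (by gcongr; exact hAj _ _)
    rw [← hTT]
    by_cases hj : j = 0
    · subst hj
      simp only [pow_zero, one_mul] at h1 ⊢
      refine h1.trans ?_
      by_cases hi : i < n
      · calc ‖w i‖ * ‖w l‖ ≤ T * (θ * T) := by
              gcongr
              · exact hall i
              · exact hhigh l (by omega)
          _ = _ := by ring
      · calc ‖w i‖ * ‖w l‖ ≤ (θ * T) * T := by
              gcongr
              · exact hhigh i (by omega)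
              · exact hall l
          _ = _ := by ring
    · have hpow' : θ ^ j ≤ θ := pow_le_of_le_one hθ hθ1 hj
      calc _ ≤ ‖w i‖ * (θ ^ j * ‖w l‖) := h1
        _ ≤ T * (θ * T) := by
            gcongr
            · exact hall i
            · exact hall l
        _ = _ := by ring
  have hterm : ∀ i j l, (if j = 0 ∧ i < n ∧ l < n then g (i + l) * (inner ℂ (w i) (w l)).re
      else 0) - M * (θ * S) ≤ g (i + j + l) * (inner ℂ (w i) ((A ^ j) (w l))).re := by
    intro i j l
    split_ifs with h
    · obtain ⟨rfl, -, -⟩ := h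
      have : 0 ≤ M * (θ * S) := by positivity
      simpa using this
    · rw [zero_sub]
      refine (abs_le.mp ?_).1
      rw [abs_mul]
      gcongr
      · exact hg _
      · exact (Complex.abs_re_le_norm _).trans (hsmall i j l h)
  have hmain : ∑ i ∈ range d, ∑ j ∈ range d, ∑ l ∈ range d,
      (if j = 0 ∧ i < n ∧ l < n then g (i + l) * (inner ℂ (w i) (w l)).re else 0) =
      ∑ i ∈ range n, ∑ l ∈ range n, g (i + l) * (inner ℂ (w i) (w l)).re := by
    rcases Nat.eq_zero_or_pos d with rfl | hd
    · obtain rfl : n = 0 := by omega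
      simp
    · have hfilter : (range d).filter (· < n) = range n := by
        ext; simp; omega
      have hinner : ∀ i, ∑ j ∈ range d, ∑ l ∈ range d,
          (if j = 0 ∧ i < n ∧ l < n then g (i + l) * (inner ℂ (w i) (w l)).re else 0) =
          if i < n then ∑ l ∈ range n, g (i + l) * (inner ℂ (w i) (w l)).re else 0 := by
        intro i
        rw [sum_eq_single_of_mem 0 (mem_range.mpr hd) (fun j _ hj => by simp [hj])]
        by_cases hi : i < n
        · simp [hi, ← hfilter, sum_filter]
        · simp [hi]
      simp_rw [hinner]
      rw [← sum_filter, hfilter]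
  calc (0 : ℝ) ≤ c * S - d ^ 3 * (M * θ) * S := by
        rw [← sub_mul]; exact mul_nonneg (by linarith) hS0
    _ ≤ (∑ i ∈ range n, ∑ l ∈ range n, g (i + l) * (inner ℂ (w i) (w l)).re) -
        d ^ 3 * (M * θ) * S := by gcongr; exact hpos w
    _ = ∑ i ∈ range d, ∑ j ∈ range d, ∑ l ∈ range d,
        ((if j = 0 ∧ i < n ∧ l < n then g (i + l) * (inner ℂ (w i) (w l)).re
      else 0) - M * (θ * S)) := by
        simp only [sum_sub_distrib, hmain]
        simp
        ring
    _ ≤ _ := sum_le_sum fun i _ => sum_le_sum fun j _ => sum_le_sum fun l _ => hterm i j l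

end Hankel

/-! ### The Cayley–Hamilton relation of a small matrix -/

section CayleyHamilton

open scoped Matrix.Norms.L2Operator

/-- The coefficients of the characteristic polynomial are small if the matrix is. -/
theorem exists_pow_eq_sum_of_norm_le {n : ℕ} {X : Matrix (Fin n) (Fin n) ℂ} {ε : ℝ}
    (hε1 : ε ≤ 1) (hX : ‖X‖ ≤ ε) :
    ∃ a : ℕ → ℂ, ∑ l ∈ Finset.range n, ‖a l‖ ≤ 2 ^ n * ε ∧
      X ^ n = ∑ l ∈ Finset.range n, a l • X ^ l := by
  have hε : 0 ≤ ε := (norm_nonneg _).trans hX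
  have hdeg : X.charpoly.natDegree = n := by simp
  refine ⟨fun l => -X.charpoly.coeff l, ?_, ?_⟩
  · have hroots : ∀ z ∈ (X.charpoly.map (RingHom.id ℂ)).roots, ‖z‖ ≤ ε := by
      intro z hz
      rw [Polynomial.map_id] at hz
      have hz' := Matrix.mem_spectrum_of_isRoot_charpoly (Polynomial.isRoot_of_mem_roots hz)
      rcases isEmpty_or_nonempty (Fin n) with h | h
      · simp [Matrix.charpoly, Matrix.det_isEmpty] at hz
      · exact (spectrum.norm_le_norm_of_mem hz').trans hX
    have hcoeff : ∀ l ∈ Finset.range n, ‖-X.charpoly.coeff l‖ ≤ ε * n.choose l := by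
      intro l hl
      have := Polynomial.coeff_le_of_roots_le (f := RingHom.id ℂ) l X.charpoly_monic
        (IsAlgClosed.splits _) hroots
      rw [Polynomial.map_id, hdeg] at this
      rw [norm_neg]
      refine this.trans ?_
      gcongr
      exact pow_le_of_le_one hε hε1 (by have := Finset.mem_range.mp hl; omega)
    refine (Finset.sum_le_sum hcoeff).trans ?_
    rw [← Finset.mul_sum, mul_comm]
    gcongr
    have := Nat.sum_range_choose n
    rw [Finset.sum_range_succ] at this
    exact_mod_cast (by omega : ∑ l ∈ Finset.range n, n.choose l ≤ 2 ^ n)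
  · have h := X.aeval_self_charpoly
    rw [Polynomial.aeval_eq_sum_range, hdeg, Finset.sum_range_succ] at h
    have hlead : X.charpoly.coeff n = 1 := by
      simpa [Polynomial.leadingCoeff, hdeg] using X.charpoly_monic.leadingCoeff
    rw [hlead, one_smul] at h
    simp only [neg_smul, Finset.sum_neg_distrib]
    exact eq_neg_of_add_eq_zero_right h

end CayleyHamilton

/-! ### Quadratic forms and the polynomial functional calculus -/

section QuadForm

open scoped Matrix.Norms.L2Operator

variable {n : ℕ}

/-- The quadratic form `M ↦ re ⟪v, M v⟫`, as a real linear functional of the matrix `M`. -/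
noncomputable def quadForm (v : EuclideanSpace ℂ (Fin n)) :
    Matrix (Fin n) (Fin n) ℂ →L[ℝ] ℝ :=
  LinearMap.toContinuousLinearMap
    { toFun := fun M => (inner ℂ v (Matrix.toEuclideanCLM (n := Fin n) (𝕜 := ℂ) M v)).re
      map_add' := fun M N => by simp
      map_smul' := fun r M => by
        rw [← Complex.coe_smul, map_smul]
        simp }

theorem quadForm_apply (v : EuclideanSpace ℂ (Fin n)) (M : Matrix (Fin n) (Fin n) ℂ) :
    quadForm v M = (inner ℂ v (Matrix.toEuclideanCLM (n := Fin n) (𝕜 := ℂ) M v)).re := rfl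

theorem le_iff_forall_quadForm_le {A B : Matrix (Fin n) (Fin n) ℂ} (hA : A.IsHermitian)
    (hB : B.IsHermitian) : A ≤ B ↔ ∀ v, quadForm v A ≤ quadForm v B := by
  rw [Matrix.le_iff, ← Matrix.isPositive_toEuclideanLin_iff, LinearMap.IsPositive,
    Matrix.isSymmetric_toEuclideanLin_iff, and_iff_right (hB.sub hA)]
  refine forall_congr' fun v => ?_
  rw [← sub_nonneg (b := quadForm v A), ← map_sub, quadForm_apply, ← inner_re_symm]
  rfl

theorem quadForm_conjTranspose_mul_mul (v : EuclideanSpace ℂ (Fin n))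
    (P M Q : Matrix (Fin n) (Fin n) ℂ) :
    quadForm v (P.conjTranspose * M * Q) =
      (inner ℂ (Matrix.toEuclideanCLM (n := Fin n) (𝕜 := ℂ) P v)
        (Matrix.toEuclideanCLM (n := Fin n) (𝕜 := ℂ) M
          (Matrix.toEuclideanCLM (n := Fin n) (𝕜 := ℂ) Q v))).re := by
  rw [quadForm_apply, ← Matrix.star_eq_conjTranspose, map_mul, map_mul, map_star,
    ContinuousLinearMap.star_eq_adjoint, mul_apply_eq_comp, mul_apply_eq_comp,
    ContinuousLinearMap.adjoint_inner_right]

theorem isHermitian_aeval {A : Matrix (Fin n) (Fin n) ℂ} (hA : A.IsHermitian)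
    (p : Polynomial ℝ) : (Polynomial.aeval A p).IsHermitian := by
  rw [← cfc_polynomial p A hA.isSelfAdjoint]
  exact cfc_predicate _ _

theorem isHermitian_smul_real {A : Matrix (Fin n) (Fin n) ℂ} (hA : A.IsHermitian) (c : ℝ) :
    (c • A).IsHermitian :=
  IsSelfAdjoint.smul (IsSelfAdjoint.all c) hA

theorem nConvexOn_eval_iff {I : Set ℝ} {p : Polynomial ℝ} :
    NConvexOn n I (fun t => p.eval t) ↔
      ∀ A B : Matrix (Fin n) (Fin n) ℂ, A.IsHermitian → B.IsHermitian →
        spectrum ℝ A ⊆ I → spectrum ℝ B ⊆ I → ∀ c : ℝ, 0 ≤ c → c ≤ 1 → ∀ v,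
          quadForm v (Polynomial.aeval (c • A + (1 - c) • B) p) ≤
            c * quadForm v (Polynomial.aeval A p) +
              (1 - c) * quadForm v (Polynomial.aeval B p) := by
  refine forall₂_congr fun A B => forall₂_congr fun hA hB => forall₂_congr fun _ _ =>
    forall_congr' fun c => forall₂_congr fun _ _ => ?_
  have hC := (isHermitian_smul_real hA c).add (isHermitian_smul_real hB (1 - c))
  rw [cfc_polynomial p _ hA.isSelfAdjoint, cfc_polynomial p _ hB.isSelfAdjoint,
    cfc_polynomial p _ hC.isSelfAdjoint,
    le_iff_forall_quadForm_le (isHermitian_aeval hC p)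
      ((isHermitian_smul_real (isHermitian_aeval hA p) c).add
        (isHermitian_smul_real (isHermitian_aeval hB p) (1 - c)))]
  simp only [map_add, map_smul, smul_eq_mul]

theorem norm_le_of_spectrum_subset_Icc {A : Matrix (Fin n) (Fin n) ℂ} (hA : A.IsHermitian)
    {ε : ℝ} (hε : 0 ≤ ε) (h : spectrum ℝ A ⊆ Set.Icc (-ε) ε) : ‖A‖ ≤ ε := by
  rw [← cfc_id' ℝ A hA.isSelfAdjoint]
  exact norm_cfc_le hε fun x hx => abs_le.mpr (h hx)

theorem hasDerivAt_quadForm_aeval (v : EuclideanSpace ℂ (Fin n)) (p : Polynomial ℝ) {d : ℕ}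
    (hd : p.natDegree < d) (X H : Matrix (Fin n) (Fin n) ℂ) (t : ℝ) :
    HasDerivAt (fun s : ℝ => quadForm v (Polynomial.aeval (X + s • H) p))
      (quadForm v (polyDeriv p d (X + t • H) H)) t :=
  (quadForm v).hasFDerivAt.comp_hasDerivAt t (hasDerivAt_aeval_line p hd X H t)

theorem hasDerivAt_quadForm_polyDeriv (v : EuclideanSpace ℂ (Fin n)) (p : Polynomial ℝ) {d : ℕ}
    (hd : p.natDegree < d) (X H : Matrix (Fin n) (Fin n) ℂ) (t : ℝ) :
    HasDerivAt (fun s : ℝ => quadForm v (polyDeriv p d (X + s • H) H))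
      (2 * quadForm v (polyHalfDeriv2 p d (X + t • H) H)) t := by
  simpa only [map_smul, smul_eq_mul, Function.comp_def] using
    (quadForm v).hasFDerivAt.comp_hasDerivAt t (hasDerivAt_polyDeriv_line p hd X H t)

/-- Matrices with spectrum in `[-ε, ε]` form the ball of radius `ε`, so the segment between two of
them stays there, and convexity along it follows from the second derivative. -/
theorem nConvexOn_Icc_of_polyHalfDeriv2_nonneg {p : Polynomial ℝ} {d : ℕ}
    (hd : p.natDegree < d) {ε : ℝ} (hε : 0 ≤ ε)
    (h : ∀ X H : Matrix (Fin n) (Fin n) ℂ, X.IsHermitian → H.IsHermitian → ‖X‖ ≤ ε →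
      ∀ v, 0 ≤ quadForm v (polyHalfDeriv2 p d X H)) :
    NConvexOn n (Set.Icc (-ε) ε) (fun t => p.eval t) := by
  rw [nConvexOn_eval_iff]
  intro A B hA hB hA' hB' c hc0 hc1 v
  have hAn := norm_le_of_spectrum_subset_Icc hA hε hA'
  have hBn := norm_le_of_spectrum_subset_Icc hB hε hB'
  have hH := hA.sub hB
  have hnorm : ∀ t ∈ Set.Icc (0 : ℝ) 1, ‖B + t • (A - B)‖ ≤ ε := by
    intro t ht
    have := (convex_closedBall (0 : Matrix (Fin n) (Fin n) ℂ) ε).add_smul_sub_mem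
      (mem_closedBall_zero_iff.mpr hBn) (mem_closedBall_zero_iff.mpr hAn) ht
    exact mem_closedBall_zero_iff.mp this
  have hconv : ConvexOn ℝ (Set.Icc 0 1)
      (fun t : ℝ => quadForm v (Polynomial.aeval (B + t • (A - B)) p)) := by
    refine convexOn_of_hasDerivWithinAt2_nonneg (convex_Icc 0 1)
      (fun t _ => (hasDerivAt_quadForm_aeval v p hd B (A - B) t).continuousAt.continuousWithinAt)
      (fun t _ => (hasDerivAt_quadForm_aeval v p hd B (A - B) t).hasDerivWithinAt)
      (fun t _ => (hasDerivAt_quadForm_polyDeriv v p hd B (A - B) t).hasDerivWithinAt)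
      fun t ht => ?_
    have := h (B + t • (A - B)) (A - B) (hB.add (isHermitian_smul_real hH t)) hH
      (hnorm t (interior_subset ht)) v
    positivity
  have key := hconv.2 (x := 1) (y := 0) (by simp) (by simp) hc0 (sub_nonneg.mpr hc1) (by ring)
  have hline : c • A + (1 - c) • B = B + c • (A - B) := by
    rw [smul_sub, sub_smul, one_smul]; abel
  rw [hline]
  simpa using key

/-- The increment `B - A ≥ 0` is written as `Kᴴ * K`, and `p` is differentiated along the segment
from `A` to `B`. -/
theorem nMonotoneOn_Icc_of_polyDeriv_nonneg {p : Polynomial ℝ} {d : ℕ}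
    (hd : p.natDegree < d) {ε : ℝ} (hε : 0 ≤ ε)
    (h : ∀ X K : Matrix (Fin n) (Fin n) ℂ, X.IsHermitian → ‖X‖ ≤ ε →
      ∀ v, 0 ≤ quadForm v (polyDeriv p d X (K.conjTranspose * K))) :
    NMonotoneOn n (Set.Icc (-ε) ε) (fun t => p.eval t) := by
  intro A B hA hB hA' hB' hAB
  have hAn := norm_le_of_spectrum_subset_Icc hA hε hA'
  have hBn := norm_le_of_spectrum_subset_Icc hB hε hB'
  rw [cfc_polynomial p _ hA.isSelfAdjoint, cfc_polynomial p _ hB.isSelfAdjoint,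
    le_iff_forall_quadForm_le (isHermitian_aeval hA p) (isHermitian_aeval hB p)]
  intro v
  obtain ⟨K, hK⟩ := CStarAlgebra.nonneg_iff_eq_star_mul_self.mp (sub_nonneg.mpr hAB)
  rw [Matrix.star_eq_conjTranspose] at hK
  have hH := hB.sub hA
  have hnorm : ∀ t ∈ Set.Icc (0 : ℝ) 1, ‖A + t • (B - A)‖ ≤ ε := by
    intro t ht
    have := (convex_closedBall (0 : Matrix (Fin n) (Fin n) ℂ) ε).add_smul_sub_mem
      (mem_closedBall_zero_iff.mpr hAn) (mem_closedBall_zero_iff.mpr hBn) ht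
    exact mem_closedBall_zero_iff.mp this
  have hmono : MonotoneOn (fun t : ℝ => quadForm v (Polynomial.aeval (A + t • (B - A)) p))
      (Set.Icc 0 1) := by
    refine monotoneOn_of_hasDerivWithinAt_nonneg (convex_Icc 0 1)
      (fun t _ => (hasDerivAt_quadForm_aeval v p hd A (B - A) t).continuousAt.continuousWithinAt)
      (fun t _ => (hasDerivAt_quadForm_aeval v p hd A (B - A) t).hasDerivWithinAt)
      fun t ht => ?_
    have := h (A + t • (B - A)) K (hA.add (isHermitian_smul_real hH t))
      (hnorm t (interior_subset ht)) v
    rwa [← hK] at this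
  simpa using hmono (by simp) (by simp) zero_le_one

end QuadForm

/-! ### Polynomials whose coefficients are moments -/

section Moments

open scoped Matrix.Norms.L2Operator
open Finset

variable {n : ℕ}

/-- For matrices `X` of small norm, the vectors `K X ^ i v` satisfy the small recursion given by
the Cayley–Hamilton relation, so the sum below has the sign of the Hankel form of `g`. -/
theorem exists_sum_moment_inner_nonneg {d : ℕ} (hnd : n ≤ d) {x y : Fin n → ℝ}
    (hx : Function.Injective x) (hy : ∀ s, 1 ≤ y s) {g : ℕ → ℝ} {M : ℝ} (hM : ∀ k, |g k| ≤ M)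
    (hg : ∀ i < n, ∀ l < n, g (i + l) = ∑ s, y s * x s ^ (i + l)) :
    ∃ ε : ℝ, 0 < ε ∧ ∀ X K : Matrix (Fin n) (Fin n) ℂ, ‖X‖ ≤ ε →
      ∀ A : EuclideanSpace ℂ (Fin n) →L[ℂ] EuclideanSpace ℂ (Fin n), ‖A‖ ≤ ε →
      ∀ v, 0 ≤ ∑ i ∈ range d, ∑ j ∈ range d, ∑ l ∈ range d,
        g (i + j + l) * (inner ℂ (Matrix.toEuclideanCLM (n := Fin n) (𝕜 := ℂ) (K * X ^ i) v)
          ((A ^ j) (Matrix.toEuclideanCLM (n := Fin n) (𝕜 := ℂ) (K * X ^ l) v))).re := by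
  obtain ⟨C, hC, hCw⟩ :=
    exists_sum_norm_sq_le_sum_vandermonde (E := EuclideanSpace ℂ (Fin n)) n x hx
  have hM0 : 0 ≤ M := (abs_nonneg _).trans (hM 0)
  have hD : 0 < d ^ 3 * M + 1 := by positivity
  set θ : ℝ := min 1 (C⁻¹ / (d ^ 3 * M + 1)) with hθ
  have hθ0 : 0 < θ := by positivity
  have hθ1 : θ ≤ 1 := min_le_left _ _
  have h2 : (1 : ℝ) ≤ 2 ^ n := one_le_pow₀ one_le_two
  have hεθ : θ / 2 ^ n ≤ θ := div_le_self hθ0.le h2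
  refine ⟨θ / 2 ^ n, by positivity, fun X K hX A hA v => ?_⟩
  obtain ⟨a, ha, hXa⟩ := exists_pow_eq_sum_of_norm_le (hεθ.trans hθ1) hX
  rw [mul_div_cancel₀ _ (by positivity)] at ha
  refine sum_hankel_inner_nonneg (c := C⁻¹) hnd ?_ hM hθ0.le hθ1 ?_ (hA.trans hεθ) ha
    (w := fun i => Matrix.toEuclideanCLM (n := Fin n) (𝕜 := ℂ) (K * X ^ i) v) ?_
  · intro w
    have hsum : ∑ i ∈ range n, ∑ l ∈ range n, g (i + l) * (inner ℂ (w i) (w l)).re =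
        ∑ s, y s * ‖∑ i ∈ range n, x s ^ i • w i‖ ^ 2 := by
      rw [← sum_sum_moment_inner_eq]
      refine sum_congr rfl fun i hi => sum_congr rfl fun l hl => ?_
      rw [hg i (mem_range.mp hi) l (mem_range.mp hl)]
    rw [hsum, inv_mul_le_iff₀ hC]
    refine (hCw w).trans ?_
    gcongr with s
    exact le_mul_of_one_le_left (by positivity) (hy s)
  · have : θ * (d ^ 3 * M + 1) ≤ C⁻¹ := (le_div_iff₀ hD).mp (min_le_right _ _)
    nlinarith
  · intro i
    have : K * X ^ (i + n) = ∑ l ∈ range n, a l • (K * X ^ (i + l)) := by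
      rw [pow_add, hXa, mul_sum, mul_sum]
      refine sum_congr rfl fun l _ => ?_
      rw [mul_smul_comm, mul_smul_comm, pow_add]
    simp only [this, map_sum, map_smul, _root_.sum_apply,
      _root_.smul_apply]

theorem exists_abs_coeff_le (p : Polynomial ℝ) (r : ℕ) : ∃ M, ∀ k, |p.coeff (k + r)| ≤ M := by
  refine ⟨∑ i ∈ p.support, |p.coeff i|, fun k => ?_⟩
  by_cases h : k + r ∈ p.support
  · exact single_le_sum (f := fun i => |p.coeff i|) (fun _ _ => abs_nonneg _) h
  · rw [Polynomial.notMem_support_iff.mp h, abs_zero]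
    positivity

/-- A polynomial is `n`-convex near `0` if its coefficients from degree `2` to degree `2 * n` are
moments of a positive measure supported on `n` points. -/
theorem exists_nConvexOn_Icc (p : Polynomial ℝ) {x y : Fin n → ℝ} (hx : Function.Injective x)
    (hy : ∀ s, 1 ≤ y s)
    (hp : ∀ i < n, ∀ l < n, p.coeff (i + l + 2) = ∑ s, y s * x s ^ (i + l)) :
    ∃ ε : ℝ, 0 < ε ∧ NConvexOn n (Set.Icc (-ε) ε) (fun t => p.eval t) := by
  obtain ⟨M, hM⟩ := exists_abs_coeff_le p 2
  obtain ⟨ε, hε, h⟩ := exists_sum_moment_inner_nonneg (d := n + p.natDegree + 1)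
    (by omega) hx hy (g := fun k => p.coeff (k + 2)) hM hp
  refine ⟨ε, hε, nConvexOn_Icc_of_polyHalfDeriv2_nonneg (d := n + p.natDegree + 1) (by omega)
    hε.le fun X H hX hH hXε v => ?_⟩
  convert h X H hXε (Matrix.toEuclideanCLM (n := Fin n) (𝕜 := ℂ) X) hXε v using 1
  simp only [polyHalfDeriv2, map_sum, map_smul, smul_eq_mul]
  refine sum_congr rfl fun i _ => sum_congr rfl fun j _ => sum_congr rfl fun l _ => ?_
  congr 1
  rw [← map_pow, ← quadForm_conjTranspose_mul_mul, Matrix.conjTranspose_mul, hH.eq,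
    (hX.pow i).eq]
  simp only [mul_assoc]

/-- A polynomial is `n`-monotone near `0` if its coefficients from degree `1` to degree
`2 * n - 1` are moments of a positive measure supported on `n` points. -/
theorem exists_nMonotoneOn_Icc (p : Polynomial ℝ) {x y : Fin n → ℝ}
    (hx : Function.Injective x) (hy : ∀ s, 1 ≤ y s)
    (hp : ∀ i < n, ∀ l < n, p.coeff (i + l + 1) = ∑ s, y s * x s ^ (i + l)) :
    ∃ ε : ℝ, 0 < ε ∧ NMonotoneOn n (Set.Icc (-ε) ε) (fun t => p.eval t) := by
  obtain ⟨M, hM⟩ := exists_abs_coeff_le p 1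
  obtain ⟨ε, hε, h⟩ := exists_sum_moment_inner_nonneg (d := n + p.natDegree + 1)
    (by omega) hx hy (g := fun k => p.coeff (k + 1)) hM hp
  refine ⟨ε, hε, nMonotoneOn_Icc_of_polyDeriv_nonneg (d := n + p.natDegree + 1) (by omega)
    hε.le fun X K hX hXε v => ?_⟩
  -- With the zero operator in the middle, only the terms with `j = 0` survive.
  convert h X K hXε 0 (by simpa using hε.le) v using 1
  simp only [polyDeriv, map_sum, map_smul, smul_eq_mul]
  refine sum_congr rfl fun i _ => ?_
  conv_rhs => rw [sum_eq_single_of_mem 0 (by simp) (fun j _ hj => by simp [zero_pow hj])]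
  refine sum_congr rfl fun l _ => ?_
  rw [pow_zero, add_zero]
  congr 1
  rw [← map_one (Matrix.toEuclideanCLM (n := Fin n) (𝕜 := ℂ)), ← quadForm_conjTranspose_mul_mul,
    Matrix.conjTranspose_mul, (hX.pow i).eq]
  simp only [mul_assoc, mul_one]

end Moments

/-! ### Failure of convexity in one dimension more -/

section NotConvex

open scoped Matrix.Norms.L2Operator
open Finset

/-- If `α` vanishes up to `b` except at `a` and `b`, only the pairs `(a, a)`, `(a, b)` and `(b, a)`
contribute: `(b, b)`, and any pair with a member above `b`, either exceeds the degree `a + b + 2`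
of `p` or has a member below `a`. -/
theorem sum_coeff_mul_eq {p : Polynomial ℝ} {a b d : ℕ} (hab : a < b) (hbd : b < d)
    (hp : p.natDegree = a + b + 2) {α β : ℕ → ℝ}
    (hα : ∀ l ≤ b, l ≠ a → l ≠ b → α l = 0) :
    ∑ i ∈ range d, ∑ j ∈ range d, ∑ l ∈ range d, p.coeff (i + j + l + 2) * (α i * β j * α l) =
      α a ^ 2 * ∑ j ∈ range d, p.coeff (2 * a + j + 2) * β j +
        2 * (α a * α b * p.leadingCoeff * β 0) := by
  have hc : ∀ k, a + b + 2 < k → p.coeff k = 0 := fun k hk =>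
    p.coeff_eq_zero_of_natDegree_lt (by omega)
  have hswap : ∀ i, ∑ j ∈ range d, ∑ l ∈ range d,
      p.coeff (i + j + l + 2) * (α i * β j * α l) =
      ∑ l ∈ range d, ∑ j ∈ range d, p.coeff (i + j + l + 2) * (α i * β j * α l) :=
    fun i => sum_comm
  simp_rw [hswap]
  have hzero : ∀ i l, ¬ (i = a ∧ (l = a ∨ l = b) ∨ i = b ∧ l = a) →
      ∑ j ∈ range d, p.coeff (i + j + l + 2) * (α i * β j * α l) = 0 := by
    intro i l h
    refine sum_eq_zero fun j _ => ?_
    by_cases hdeg : a + b < i + j + l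
    · rw [hc _ (by omega), zero_mul]
    · have : α i = 0 ∨ α l = 0 := by
        by_cases hi : i ≤ b ∧ i ≠ a ∧ i ≠ b
        · exact Or.inl (hα i hi.1 hi.2.1 hi.2.2)
        · exact Or.inr (hα l (by omega) (by omega) (by omega))
      rcases this with h0 | h0 <;> simp [h0]
  have hlead : ∀ i l, i + l = a + b →
      ∑ j ∈ range d, p.coeff (i + j + l + 2) * (α i * β j * α l) =
        α i * α l * p.leadingCoeff * β 0 := by
    intro i l hil
    rw [sum_eq_single_of_mem 0 (mem_range.mpr (by omega))
      (fun j _ hj => by rw [hc _ (by omega), zero_mul])]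
    rw [show i + 0 + l + 2 = p.natDegree by omega, Polynomial.coeff_natDegree]
    ring
  rw [sum_eq_add_of_mem a b (mem_range.mpr (by omega)) (mem_range.mpr hbd) hab.ne
      (fun i _ hi => sum_eq_zero fun l _ => hzero i l (by omega)),
    sum_eq_add_of_mem a b (mem_range.mpr (by omega)) (mem_range.mpr hbd) hab.ne
      (fun l _ hl => hzero a l (by omega)),
    sum_eq_single_of_mem a (mem_range.mpr (by omega)) (fun l _ hl => hzero b l (by omega)),
    hlead a b rfl, hlead b a (by omega)]
  have haa : ∑ j ∈ range d, p.coeff (a + j + a + 2) * (α a * β j * α a) =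
      α a ^ 2 * ∑ j ∈ range d, p.coeff (2 * a + j + 2) * β j := by
    rw [mul_sum]
    refine sum_congr rfl fun j _ => ?_
    rw [show a + j + a + 2 = 2 * a + j + 2 by ring]
    ring
  rw [haa]
  ring

/-- Distinct nodes carry a real weight with prescribed moments. -/
theorem exists_weight_moment_eq {N : ℕ} {x : Fin N → ℝ} (hx : Function.Injective x)
    (α : ℕ → ℝ) : ∃ h : Fin N → ℝ, ∀ l < N, ∑ s, h s * x s ^ l = α l := by
  have hdet : IsUnit (Matrix.vandermonde x).det :=
    isUnit_iff_ne_zero.mpr (Matrix.det_vandermonde_ne_zero_iff.mpr hx)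
  refine ⟨Matrix.vecMul (fun l : Fin N => α l) (Matrix.vandermonde x)⁻¹, fun l hl => ?_⟩
  have h : Matrix.vecMul (Matrix.vecMul (fun l : Fin N => α l) (Matrix.vandermonde x)⁻¹)
      (Matrix.vandermonde x) = fun l : Fin N => α l := by
    rw [Matrix.vecMul_vecMul, Matrix.nonsing_inv_mul _ hdet, Matrix.vecMul_one]
  exact congrFun h ⟨l, hl⟩

/-- A weight `h` whose moments make the second derivative of `p` negative: the moment of order `b`
is `1`, the one of order `a` is a small `-δ`, and the others up to order `b` vanish. -/
theorem exists_weight_sum_neg {p : Polynomial ℝ} {a b d : ℕ} (hab : a < b) (hbd : b < d)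
    (hp : p.natDegree = a + b + 2) (hlead : 0 < p.leadingCoeff) {x : Fin (b + 1) → ℝ}
    (hx : Function.Injective x) :
    ∃ h : Fin (b + 1) → ℝ, ∑ i ∈ range d, ∑ j ∈ range d, ∑ l ∈ range d,
      p.coeff (i + j + l + 2) *
        ((∑ s, h s * x s ^ i) * (∑ s, h s ^ 2 * x s ^ j) * ∑ s, h s * x s ^ l) < 0 := by
  obtain ⟨u, hu⟩ := exists_weight_moment_eq hx (fun l => if l = b then 1 else 0)
  obtain ⟨v, hv⟩ := exists_weight_moment_eq hx (fun l => if l = a then 1 else 0)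
  have hmom : ∀ δ : ℝ, ∀ l ≤ b, ∑ s, (u s - δ * v s) * x s ^ l =
      (if l = b then 1 else 0) - δ * if l = a then 1 else 0 := by
    intro δ l hl
    rw [← hu l (by omega), ← hv l (by omega), mul_sum, ← sum_sub_distrib]
    exact sum_congr rfl fun s _ => by ring
  -- The sum in question is `δ * G δ`.
  set G : ℝ → ℝ := fun δ =>
    δ * (∑ j ∈ range d, p.coeff (2 * a + j + 2) * ∑ s, (u s - δ * v s) ^ 2 * x s ^ j) -
      2 * (p.leadingCoeff * ∑ s, (u s - δ * v s) ^ 2 * x s ^ 0) with hG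
  have hGcont : Continuous G := by fun_prop
  have hG0 : G 0 < 0 := by
    have hne : u ≠ 0 := by
      rintro rfl
      simpa using hu b (by omega)
    obtain ⟨s, hs⟩ := Function.ne_iff.mp hne
    have : 0 < ∑ s, u s ^ 2 := sum_pos' (fun _ _ => sq_nonneg _) ⟨s, mem_univ s, by
      have : u s ≠ 0 := hs
      positivity⟩
    have := mul_pos hlead this
    simp only [hG]
    simp
    linarith
  obtain ⟨δ, hδ, hδ0⟩ := ((hGcont.continuousAt.eventually_lt_const hG0).filter_mono
    nhdsWithin_le_nhds |>.and (self_mem_nhdsWithin (s := Set.Ioi (0 : ℝ)))).exists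
  have hδ0 : 0 < δ := hδ0
  refine ⟨fun s => u s - δ * v s, ?_⟩
  rw [sum_coeff_mul_eq (α := fun l => ∑ s, (u s - δ * v s) * x s ^ l)
    (β := fun j => ∑ s, (u s - δ * v s) ^ 2 * x s ^ j) hab hbd hp
    (fun l hl hla hlb => by simp [hmom δ l hl, hla, hlb])]
  simp only [hmom δ a hab.le, hmom δ b le_rfl, if_neg hab.ne, if_neg hab.ne', if_true]
  have := mul_neg_of_pos_of_neg hδ0 hδ
  simp only [hG] at this
  linarith

theorem quadForm_one {N : ℕ} (M : Matrix (Fin N) (Fin N) ℂ) :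
    quadForm (WithLp.toLp 2 fun _ => 1) M = (∑ s, ∑ t, M s t).re := by
  rw [quadForm_apply, Matrix.toEuclideanCLM_toLp, EuclideanSpace.inner_toLp_toLp]
  simp [dotProduct, Matrix.mulVec]

/-- In the direction of a rank one matrix, at a diagonal matrix, the second derivative is a sum of
products of moments. -/
theorem quadForm_polyHalfDeriv2_diagonal {N : ℕ} (p : Polynomial ℝ) (d : ℕ) (x h : Fin N → ℝ) :
    quadForm (WithLp.toLp 2 fun _ => 1) (polyHalfDeriv2 p d
        (Matrix.diagonal fun s => (x s : ℂ))
        (Matrix.vecMulVec (fun s => (h s : ℂ)) fun s => (h s : ℂ))) =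
      ∑ i ∈ range d, ∑ j ∈ range d, ∑ l ∈ range d, p.coeff (i + j + l + 2) *
        ((∑ s, h s * x s ^ i) * (∑ s, h s ^ 2 * x s ^ j) * ∑ s, h s * x s ^ l) := by
  simp only [polyHalfDeriv2, map_sum, map_smul, smul_eq_mul]
  refine sum_congr rfl fun i _ => sum_congr rfl fun j _ => sum_congr rfl fun l _ => ?_
  congr 1
  rw [quadForm_one, ← Complex.ofReal_re (_ * _)]
  congr 1
  push_cast
  have hentry : ∀ s t, (Matrix.diagonal (fun s => (x s : ℂ)) ^ i *
      Matrix.vecMulVec (fun s => (h s : ℂ)) (fun s => (h s : ℂ)) *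
      Matrix.diagonal (fun s => (x s : ℂ)) ^ j *
      Matrix.vecMulVec (fun s => (h s : ℂ)) (fun s => (h s : ℂ)) *
      Matrix.diagonal (fun s => (x s : ℂ)) ^ l) s t =
      (h s * x s ^ i) * (∑ r, (h r : ℂ) ^ 2 * x r ^ j) * (h t * x t ^ l) := by
    intro s t
    rw [Matrix.diagonal_pow, Matrix.diagonal_pow, Matrix.diagonal_pow, Matrix.mul_diagonal,
      Matrix.mul_apply]
    simp only [Matrix.mul_diagonal, Matrix.diagonal_mul, Matrix.vecMulVec_apply, Pi.pow_apply]
    rw [mul_sum, sum_mul, sum_mul]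
    exact sum_congr rfl fun r _ => by ring
  simp_rw [hentry, ← mul_sum, ← sum_mul]

theorem spectrum_subset_Icc_of_norm_sub_le {N : ℕ} [NeZero N] {X : Matrix (Fin N) (Fin N) ℂ}
    {m r : ℝ} (h : ‖X - algebraMap ℝ _ m‖ ≤ r) : spectrum ℝ X ⊆ Set.Icc (m - r) (m + r) := by
  intro z hz
  have hz' : z - m ∈ spectrum ℝ (X - algebraMap ℝ _ m) := by
    rw [spectrum.mem_iff] at hz ⊢
    simpa using hz
  have := (spectrum.norm_le_norm_of_mem hz').trans h
  rw [Real.norm_eq_abs, abs_le] at this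
  constructor <;> linarith [this.1, this.2]

theorem polyHalfDeriv2_nonneg_of_nConvexOn {N : ℕ} [NeZero N] {p : Polynomial ℝ} {d : ℕ}
    (hd : p.natDegree < d) {J : Set ℝ} {m r : ℝ} (hr : 0 < r)
    (hJ : Set.Icc (m - r) (m + r) ⊆ J) (hp : NConvexOn N J (fun t => p.eval t))
    {X H : Matrix (Fin N) (Fin N) ℂ} (hX : X.IsHermitian) (hH : H.IsHermitian)
    (hXm : ‖X - algebraMap ℝ _ m‖ ≤ r / 2) (v : EuclideanSpace ℂ (Fin N)) :
    0 ≤ quadForm v (polyHalfDeriv2 p d X H) := by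
  rw [nConvexOn_eval_iff] at hp
  -- The line `X + t • H` stays in the ball of radius `r` around `m` for `|t| < τ`.
  set τ := r / 2 / (‖H‖ + 1) with hτ
  have hτ0 : 0 < τ := by positivity
  have hspec : ∀ t ∈ Set.Ioo (-τ) τ, spectrum ℝ (X + t • H) ⊆ J := by
    intro t ht
    refine (spectrum_subset_Icc_of_norm_sub_le ?_).trans hJ
    rw [add_sub_right_comm]
    refine (norm_add_le _ _).trans ?_
    have h1 : ‖t • H‖ ≤ τ * (‖H‖ + 1) := by
      rw [norm_smul]
      gcongr
      · exact (abs_lt.mpr ht).le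
      · linarith
    rw [hτ, div_mul_cancel₀ _ (by positivity)] at h1
    linarith
  have hconv : ConvexOn ℝ (Set.Ioo (-τ) τ)
      (fun t : ℝ => quadForm v (Polynomial.aeval (X + t • H) p)) := by
    refine ⟨convex_Ioo _ _, fun s hs t ht c e hc he hce => ?_⟩
    obtain rfl : e = 1 - c := by linarith
    have h := hp (X + s • H) (X + t • H) (hX.add (isHermitian_smul_real hH s))
      (hX.add (isHermitian_smul_real hH t)) (hspec s hs) (hspec t ht) c hc (by linarith) v
    have hline : c • (X + s • H) + (1 - c) • (X + t • H) =
        X + (c • s + (1 - c) • t) • H := by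
      simp only [smul_eq_mul]
      module
    rw [hline] at h
    simpa only [smul_eq_mul] using h
  have hmono := hconv.monotoneOn_deriv
    fun t _ => (hasDerivAt_quadForm_aeval v p hd X H t).differentiableAt
  rw [show deriv (fun t : ℝ => quadForm v (Polynomial.aeval (X + t • H) p)) =
    fun t => quadForm v (polyDeriv p d (X + t • H) H) from
    funext fun t => (hasDerivAt_quadForm_aeval v p hd X H t).deriv] at hmono
  have h0 := hmono.derivWithin_nonneg (x := 0)
  rw [derivWithin_of_isOpen isOpen_Ioo ⟨by linarith, hτ0⟩,
    (hasDerivAt_quadForm_polyDeriv v p hd X H 0).deriv, zero_smul, add_zero] at h0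
  linarith

/-- A polynomial of degree `a + b + 2` with `a < b` is not convex on matrices of size `b + 1`: the
local Hankel matrix of its Taylor coefficients from degree `2` on has a nonzero entry in position
`(a, b)` and a zero on the diagonal at `(b, b)`. The proof uses a diagonal matrix with distinct
entries in `J` as base point, and a direction of rank one. -/
theorem not_nConvexOn_of_natDegree_eq {p : Polynomial ℝ} {a b : ℕ} (hab : a < b)
    (hp : p.natDegree = a + b + 2) (hlead : 0 < p.leadingCoeff) {J : Set ℝ}
    (hJ : J.OrdConnected) (hJ' : J.Nontrivial) :
    ¬ NConvexOn (b + 1) J (fun t => p.eval t) := by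
  intro hconv
  obtain ⟨y, hy, z, hz, hyz⟩ := hJ'.exists_lt
  set m := (y + z) / 2 with hm
  set r := (z - y) / 2 with hr
  have hr0 : 0 < r := by rw [hr]; linarith
  -- Distinct points in the middle half of `[y, z]`.
  set x : Fin (b + 1) → ℝ := fun s => m + r / 2 * ((s : ℝ) / (b + 1)) with hx
  have hxinj : Function.Injective x := by
    intro s t hst
    have hb : (b : ℝ) + 1 ≠ 0 := by positivity
    simp only [hx, add_right_inj] at hst
    have := mul_left_cancel₀ (by positivity) hst
    rw [div_left_inj' hb] at this
    exact Fin.ext (by exact_mod_cast this)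
  obtain ⟨h, hneg⟩ := exists_weight_sum_neg hab (d := a + b + 3) (by omega) hp hlead hxinj
  rw [← quadForm_polyHalfDeriv2_diagonal] at hneg
  refine hneg.not_ge (polyHalfDeriv2_nonneg_of_nConvexOn (m := m) (by omega) hr0 ?_ hconv ?_ ?_ ?_ _)
  · rw [show m - r = y by rw [hm, hr]; ring, show m + r = z by rw [hm, hr]; ring]
    exact hJ.out hy hz
  · exact Matrix.isHermitian_diagonal_of_self_adjoint _ (by ext; simp)
  · ext s t
    simp [Matrix.vecMulVec_apply, mul_comm]
  · rw [Matrix.algebraMap_eq_diagonal, Matrix.diagonal_sub, Matrix.l2_opNorm_diagonal,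
      pi_norm_le_iff_of_nonneg (by positivity)]
    intro s
    have hs : (x s : ℂ) - (algebraMap ℝ (Fin (b + 1) → ℂ) m) s =
        ((r / 2 * ((s : ℝ) / (b + 1)) : ℝ) : ℂ) := by
      simp [hx]
    rw [hs, Complex.norm_real, Real.norm_of_nonneg (by positivity)]
    refine mul_le_of_le_one_right (by positivity) ((div_le_one (by positivity)).mpr ?_)
    have := s.2
    exact_mod_cast this.le

end NotConvex

/-! ### Rescaling and conclusion -/

section Rescaling

variable {n : ℕ}

theorem spectrum_smul_subset_Icc {A : Matrix (Fin n) (Fin n) ℂ} {c R ε : ℝ} (hc : c ≠ 0)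
    (hR : |c| * R ≤ ε) (hA : spectrum ℝ A ⊆ Set.Icc (-R) R) :
    spectrum ℝ (c • A) ⊆ Set.Icc (-ε) ε := by
  have h := spectrum.unit_smul_eq_smul A (Units.mk0 c hc)
  rw [Units.smul_mk0 hc A] at h
  rw [h]
  rintro _ ⟨z, hz, rfl⟩
  refine abs_le.mp ?_
  simp only [Units.val_mk0, smul_eq_mul, abs_mul]
  exact (mul_le_mul_of_nonneg_left (abs_le.mpr (hA hz)) (abs_nonneg c)).trans hR

theorem aeval_comp_C_mul_X (p : Polynomial ℝ) (c : ℝ) (A : Matrix (Fin n) (Fin n) ℂ) :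
    Polynomial.aeval A (p.comp (Polynomial.C c * Polynomial.X)) =
      Polynomial.aeval (c • A) p := by
  rw [Polynomial.aeval_comp]
  simp [Algebra.smul_def]

theorem NConvexOn.comp_C_mul_X {p : Polynomial ℝ} {c R ε : ℝ} (hc : c ≠ 0) (hR : |c| * R ≤ ε)
    (h : NConvexOn n (Set.Icc (-ε) ε) (fun t => p.eval t)) :
    NConvexOn n (Set.Icc (-R) R)
      (fun t => (p.comp (Polynomial.C c * Polynomial.X)).eval t) := by
  rw [nConvexOn_eval_iff] at h ⊢
  intro A B hA hB hA' hB' e he0 he1 v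
  have := h (c • A) (c • B) (isHermitian_smul_real hA c) (isHermitian_smul_real hB c)
    (spectrum_smul_subset_Icc hc hR hA') (spectrum_smul_subset_Icc hc hR hB') e he0 he1 v
  simp only [aeval_comp_C_mul_X]
  rwa [smul_add, smul_comm c e, smul_comm c (1 - e)]

theorem cfc_eval_comp_C_mul_X (p : Polynomial ℝ) (c : ℝ) {A : Matrix (Fin n) (Fin n) ℂ}
    (hA : A.IsHermitian) :
    cfc (fun t => (p.comp (Polynomial.C c * Polynomial.X)).eval t) A =
      cfc (fun t => p.eval t) (c • A) := by
  rw [cfc_polynomial _ A hA.isSelfAdjoint,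
    cfc_polynomial p _ (isHermitian_smul_real hA c).isSelfAdjoint, aeval_comp_C_mul_X]

theorem NMonotoneOn.comp_C_mul_X {p : Polynomial ℝ} {c R ε : ℝ} (hc : 0 < c)
    (hR : |c| * R ≤ ε) (h : NMonotoneOn n (Set.Icc (-ε) ε) (fun t => p.eval t)) :
    NMonotoneOn n (Set.Icc (-R) R)
      (fun t => (p.comp (Polynomial.C c * Polynomial.X)).eval t) := by
  intro A B hA hB hA' hB' hAB
  rw [cfc_eval_comp_C_mul_X p c hA, cfc_eval_comp_C_mul_X p c hB]
  exact h _ _ (isHermitian_smul_real hA c) (isHermitian_smul_real hB c)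
    (spectrum_smul_subset_Icc hc.ne' hR hA') (spectrum_smul_subset_Icc hc.ne' hR hB')
    (smul_le_smul_of_nonneg_left hAB hc.le)

theorem NMonotoneOn.nAntitoneOn_comp_C_mul_X {p : Polynomial ℝ} {c R ε : ℝ} (hc : c < 0)
    (hR : |c| * R ≤ ε) (h : NMonotoneOn n (Set.Icc (-ε) ε) (fun t => p.eval t)) :
    NAntitoneOn n (Set.Icc (-R) R)
      (fun t => (p.comp (Polynomial.C c * Polynomial.X)).eval t) := by
  intro A B hA hB hA' hB' hAB
  rw [cfc_eval_comp_C_mul_X p c hA, cfc_eval_comp_C_mul_X p c hB]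
  exact h _ _ (isHermitian_smul_real hB c) (isHermitian_smul_real hA c)
    (spectrum_smul_subset_Icc hc.ne hR hB') (spectrum_smul_subset_Icc hc.ne hR hA')
    (smul_le_smul_of_nonpos_left hAB hc.le)

theorem NConvexOn.mono {I J : Set ℝ} {f : ℝ → ℝ} (hIJ : I ⊆ J) (h : NConvexOn n J f) :
    NConvexOn n I f := fun A B hA hB hA' hB' =>
  h A B hA hB (hA'.trans hIJ) (hB'.trans hIJ)

theorem NMonotoneOn.mono {I J : Set ℝ} {f : ℝ → ℝ} (hIJ : I ⊆ J) (h : NMonotoneOn n J f) :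
    NMonotoneOn n I f := fun A B hA hB hA' hB' =>
  h A B hA hB (hA'.trans hIJ) (hB'.trans hIJ)

theorem NAntitoneOn.mono {I J : Set ℝ} {f : ℝ → ℝ} (hIJ : I ⊆ J) (h : NAntitoneOn n J f) :
    NAntitoneOn n I f := fun A B hA hB hA' hB' =>
  h A B hA hB (hA'.trans hIJ) (hB'.trans hIJ)

theorem natDegree_comp_C_mul_X (p : Polynomial ℝ) {c : ℝ} (hc : c ≠ 0) :
    (p.comp (Polynomial.C c * Polynomial.X)).natDegree = p.natDegree := by
  rw [Polynomial.natDegree_comp, Polynomial.natDegree_C_mul_X c hc, mul_one]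

theorem leadingCoeff_comp_C_mul_X (p : Polynomial ℝ) {c : ℝ} (hc : c ≠ 0) :
    (p.comp (Polynomial.C c * Polynomial.X)).leadingCoeff =
      p.leadingCoeff * c ^ p.natDegree := by
  rw [Polynomial.leadingCoeff_comp (by rw [Polynomial.natDegree_C_mul_X c hc]; exact one_ne_zero)]
  simp

/-- The polynomial with coefficients `∑ s, (s + 1) ^ k`, the moments of `n` unit point masses at
`1, …, n`, truncated at any degree `D ≥ 2 * n`. -/
theorem exists_polynomial_nConvexOn_nMonotoneOn (hn : 1 ≤ n) {D : ℕ} (hD : 2 * n ≤ D) :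
    ∃ p : Polynomial ℝ, p.natDegree = D ∧ 0 < p.leadingCoeff ∧ ∃ ε : ℝ, 0 < ε ∧
      NConvexOn n (Set.Icc (-ε) ε) (fun t => p.eval t) ∧
      NMonotoneOn n (Set.Icc (-ε) ε) (fun t => p.eval t) := by
  set x : Fin n → ℝ := fun s => (s : ℝ) + 1 with hx
  have hx1 : ∀ s, 1 ≤ x s := fun s => by simp [hx]
  have hxinj : Function.Injective x := fun s t hst => by
    simpa [hx, Fin.ext_iff] using hst
  set p : Polynomial ℝ := ∑ k ∈ Finset.range (D + 1), Polynomial.monomial k (∑ s, x s ^ k) with hp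
  have hcoeff : ∀ k ≤ D, p.coeff k = ∑ s, x s ^ k := by
    intro k hk
    rw [hp, Polynomial.finsetSum_coeff]
    simp [Polynomial.coeff_monomial, Nat.lt_succ_of_le hk]
  have hpos : 0 < p.coeff D := by
    rw [hcoeff D le_rfl]
    have : Nonempty (Fin n) := ⟨⟨0, hn⟩⟩
    exact Finset.sum_pos (fun s _ => pow_pos (by linarith [hx1 s]) _) Finset.univ_nonempty
  have hdeg : p.natDegree = D := by
    refine le_antisymm ?_ (Polynomial.le_natDegree_of_ne_zero hpos.ne')
    refine Polynomial.natDegree_sum_le_of_forall_le _ _ fun k hk => ?_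
    exact (Polynomial.natDegree_monomial_le _).trans (by simpa [Nat.lt_succ_iff] using hk)
  -- The shifted sequences are again moments, of the measures with masses `x s ^ 2` and `x s`.
  obtain ⟨ε₁, hε₁, h₁⟩ := exists_nConvexOn_Icc p (y := fun s => x s ^ 2) hxinj
    (fun s => one_le_pow₀ (hx1 s)) (fun i hi l hl => by
      rw [hcoeff _ (by omega)]
      exact Finset.sum_congr rfl fun s _ => by ring)
  obtain ⟨ε₂, hε₂, h₂⟩ := exists_nMonotoneOn_Icc p (y := x) hxinj hx1 (fun i hi l hl => by
      rw [hcoeff _ (by omega)]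
      exact Finset.sum_congr rfl fun s _ => by ring)
  refine ⟨p, hdeg, by rwa [Polynomial.leadingCoeff, hdeg], min ε₁ ε₂, lt_min hε₁ hε₂, ?_, ?_⟩
  · exact h₁.mono (Set.Icc_subset_Icc (neg_le_neg (min_le_left _ _)) (min_le_left _ _))
  · exact h₂.mono (Set.Icc_subset_Icc (neg_le_neg (min_le_right _ _)) (min_le_right _ _))

end Rescaling

theorem corollary1p5 (n : ℕ) (hn : 1 ≤ n) (I : Set ℝ) (hI : I.OrdConnected)
    (hI_nontrivial : I.Nontrivial) (hI_bounded : Bornology.IsBounded I) :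
    (∃ f : ℝ → ℝ, InConvexityGap n I f) ∧
    (2 ≤ n →
      (∃ p : Polynomial ℝ, p.natDegree = 2 * n ∧
        NMonotoneOn n I (fun t => p.eval t) ∧ InConvexityGap n I (fun t => p.eval t)) ∧
      (∃ q : Polynomial ℝ, q.natDegree = 2 * n ∧
        NAntitoneOn n I (fun t => q.eval t) ∧ InConvexityGap n I (fun t => q.eval t))) := by
  obtain ⟨R, hR, hIR⟩ := hI_bounded.exists_pos_norm_le
  have hIR' : I ⊆ Set.Icc (-R) R := fun t ht => abs_le.mp (hIR t ht)
  have hscale : ∀ ε : ℝ, 0 < ε → |ε / R| * R ≤ ε ∧ |-(ε / R)| * R ≤ ε := fun ε hε => by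
    rw [abs_neg, abs_of_pos (div_pos hε hR), div_mul_cancel₀ _ hR.ne']
    exact ⟨le_rfl, le_rfl⟩
  have hpoly : 2 ≤ n →
      (∃ p : Polynomial ℝ, p.natDegree = 2 * n ∧
        NMonotoneOn n I (fun t => p.eval t) ∧ InConvexityGap n I (fun t => p.eval t)) ∧
      (∃ q : Polynomial ℝ, q.natDegree = 2 * n ∧
        NAntitoneOn n I (fun t => q.eval t) ∧ InConvexityGap n I (fun t => q.eval t)) := by
    intro hn2
    obtain ⟨p, hdeg, hlead, ε, hε, hconv, hmono⟩ :=
      exists_polynomial_nConvexOn_nMonotoneOn hn (D := 2 * n) le_rfl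
    have hc : 0 < ε / R := div_pos hε hR
    have hgap : ∀ c : ℝ, c ≠ 0 → |c| * R ≤ ε →
        InConvexityGap n I
          (fun t => (p.comp (Polynomial.C c * Polynomial.X)).eval t) := by
      intro c hc hcR
      refine ⟨(hconv.comp_C_mul_X hc hcR).mono hIR', fun J _ hJ hJ' => ?_⟩
      refine not_nConvexOn_of_natDegree_eq (a := n - 2) (by omega) ?_ ?_ hJ hJ'
      · rw [natDegree_comp_C_mul_X p hc, hdeg]
        omega
      · rw [leadingCoeff_comp_C_mul_X p hc, hdeg]
        -- The leading coefficient stays positive for negative `c`, as the degree is even.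
        exact mul_pos hlead ((even_two_mul n).pow_pos hc)
    refine ⟨⟨_, (natDegree_comp_C_mul_X p hc.ne').trans hdeg,
      (hmono.comp_C_mul_X hc (hscale ε hε).1).mono hIR', hgap _ hc.ne' (hscale ε hε).1⟩,
      ⟨_, (natDegree_comp_C_mul_X p (neg_ne_zero.mpr hc.ne')).trans hdeg,
      (hmono.nAntitoneOn_comp_C_mul_X (neg_neg_of_pos hc) (hscale ε hε).2).mono hIR',
      hgap _ (neg_ne_zero.mpr hc.ne') (hscale ε hε).2⟩⟩
  refine ⟨?_, hpoly⟩
  rcases hn.eq_or_lt with rfl | hn2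
  · -- Quadratic polynomials with positive leading coefficient are convex on matrices of every
    -- size, so for `n = 1` a cubic is used.
    obtain ⟨p, hdeg, hlead, ε, hε, hconv, -⟩ :=
      exists_polynomial_nConvexOn_nMonotoneOn le_rfl (n := 1) (D := 3) (by norm_num)
    have hc : 0 < ε / R := div_pos hε hR
    refine ⟨_, (hconv.comp_C_mul_X hc.ne' (hscale ε hε).1).mono hIR', fun J _ hJ hJ' => ?_⟩
    refine not_nConvexOn_of_natDegree_eq (a := 0) one_pos ?_ ?_ hJ hJ'
    · exact (natDegree_comp_C_mul_X p hc.ne').trans hdeg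
    · rw [leadingCoeff_comp_C_mul_X p hc.ne']
      exact mul_pos hlead (pow_pos hc _)
  · obtain ⟨⟨p, -, -, hp⟩, -⟩ := hpoly hn2
    exact ⟨_, hp⟩
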